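/- Let $\mathcal M=(S,\mathrm{Act},P)$ be a Markov decision process with countable $S$ and $\mathrm{Act}$ and $P:S\times \mathrm{Act}\times S\to[0,1]$, where $\sum_{s'}P(s,a,s')\in\{0,1\}$ for all $(s,a)$; the action $a$ is enabled at $s$ if this sum is $1$. A scheduler $\sigma$ assigns to every history $s_0\cdots s_k$ a probability distribution on the actions enabled at $s_k$ (a path that is at a state without enabled actions stays there forever); it is pure if these distributions are Dirac, and positional if they depend only on $s_k$. Let $\mathbb P^\sigma_{\mathcal M,s}$ be the induced probability measure on paths from $s$, and $\mathbb P^{\sup}_{\mathcal M,s}(E)=\sup_\sigma \mathbb P^\sigma_{\mathcal M,s}(E)$. Write $\mathrm F$, $\mathrm F_{\le n}$, $\mathrm G_{\le n}$ for "eventually", "at some step $k\le n$", "at all steps $k\le n$". Let $s_0\in S$ be an initial state, let $\mathrm{g}\in S$ be a target state, and let $\mathrm{Av}=\{s\in S\mid \mathbb P^{\sup}_{\mathcal M,s}(\mathrm F\,\mathrm g)=0\}$. Let $\mathcal M^{\sup}$ be the MDP obtained from $\mathcal M$ by merging all states of $\mathrm{Av}$ into one state $\mathrm{bad}$ that has a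 self-loop with probability $1$ under every action; let $s_0$ also denote the image of $s_0$ in $\mathcal M^{\sup}$ (which is $\mathrm{bad}$ if $s_0\in \mathrm{Av}$). Let $S_0=\{s_0,\mathrm g,\mathrm{bad}\}$ and let $S_{n+1}$ consist of $S_n$ and all states $s'$ of $\mathcal M^{\sup}$ which some action reaches with positive probability in one step from some state of $S_n$. Let $\mathcal M^{\sup}_n$ be the MDP with the states $S_n\cup\{s_\bot^n\}$, where $s^n_\bot$ is a fresh state without enabled actions, whose transition probabilities between states of $S_n$ are those of $\mathcal M^{\sup}$, while the probability of going from $s\in S_n$ under $a$ to $s_\bot^n$ is the total probability of leaving $S_n$ from $s$ under $a$ in $\mathcal M^{\sup}$. Put $R_n=\mathrm F_{\le n}\,\mathrm g$, $H_n=\mathrm G_{\le n}(\neg \mathrm g\wedge\neg\mathrm{bad})$ and $$p_n^-=\mathbb P^{\sup}_{\mathcal M^{\sup},s_0}(R_n),\quad p_n^+=\mathbb P^{\sup}_{\mathcal M^{\sup},s_0}(R_n\vee H_n),\quad q_n^-=\mathbb P^{\sup}_{\mathcal M^{\sup}_n,s_0}(\mathrm F\,\mathrm g),\quad q_n^+=\mathbb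 P^{\sup}_{\mathcal M^{\sup}_n,s_0}(\mathrm F(\mathrm g\vee s_\bot^n)).$$ For an input precision $\epsilon>0$, $\mathrm{ApproxScheme}_1^{\sup}$ computes $p_n^-,p_n^+$ for $n=1,2,3,\dots$ until $|p_n^+-p_n^-|\le\epsilon$ for the first time, and then returns $p_n^-$; $\mathrm{ApproxScheme}_2^{\sup}$ does the same with $q_n^-,q_n^+$. **Theorem.** Assume that every state of $\mathcal M$ has only finitely many enabled actions, and that $\mathcal M$ is $\sup$-decisive w.r.t. $\mathrm g$ from $s_0$, that is, $\mathbb P^\sigma_{\mathcal M,s_0}(\mathrm F\,\mathrm g\vee \mathrm F\,\mathrm{Av})=1$ for every pure positional scheduler $\sigma$. Let $p=\mathbb P^{\sup}_{\mathcal M,s_0}(\mathrm F\,\mathrm g)$. Then $\lim_{n\to\infty}\mathbb P^{\sup}_{\mathcal M^{\sup},s_0}(H_n)=0$. Moreover both schemes terminate and are correct: for all $n$, $p_n^-\le p\le p_n^+$ and $q_n^-\le p\le q_n^+$; and for every $\epsilon>0$ each of the two schemes terminates and returns a value $v\in[0,1]$ with $|v-p|\le\epsilon$. -/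

import Mathlib

open Filter Topology
open scoped ENNReal

noncomputable section

/-- A Markov decision process with state set `S` and action set `A`: for every state and action
the transition weights sum to `1` (the action is enabled) or to `0` (it is disabled). -/
structure MDP (S A : Type*) where
  prob : S → A → S → ℝ≥0∞
  sum_prob : ∀ s a, ∑' s', prob s a s' = 0 ∨ ∑' s', prob s a s' = 1

/-- Histories of length `n`, that is state sequences `s₀ s₁ … sₙ`. -/
abbrev Hist (S : Type*) (n : ℕ) : Type _ := Finset.Iic n → S

/-- The last state of a history. -/
def Hist.last {S : Type*} {n : ℕ} (h : Hist S n) : S := h ⟨n, Finset.mem_Iic.2 le_rfl⟩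

/-- The product σ-algebra on infinite state sequences, `S` being discrete. For countable `S` this
is the σ-algebra generated by the cylinders. -/
@[reducible] def pathSpace (S : Type*) : MeasurableSpace (ℕ → S) :=
  @MeasurableSpace.pi ℕ (fun _ => S) (fun _ => ⊤)

/-! ### Path properties -/

/-- `F T`: some state of the path is in `T`. -/
def eventuallyIn {S : Type*} (T : Set S) : Set (ℕ → S) := {ρ | ∃ k, ρ k ∈ T}

/-- `F[≤ n] T`: one of the states number `0, …, n` is in `T`. -/
def eventuallyWithin {S : Type*} (n : ℕ) (T : Set S) : Set (ℕ → S) := {ρ | ∃ k ≤ n, ρ k ∈ T}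

/-- `G[≤ n] T`: all the states number `0, …, n` are in `T`. -/
def alwaysWithin {S : Type*} (n : ℕ) (T : Set S) : Set (ℕ → S) := {ρ | ∀ k ≤ n, ρ k ∈ T}

namespace MDP

variable {S A : Type*} (M : MDP S A)

/-- The actions enabled at `s`. -/
def enabled (s : S) : Set A := {a | ∑' s', M.prob s a s' = 1}

def FinitelyActionBranching : Prop := ∀ s, (M.enabled s).Finite

/-- A (history-dependent, randomised) scheduler: it assigns to every history a probability
distribution on the actions enabled at its last state. At a state without enabled actions there is
nothing to choose. -/
structure Scheduler where
  choice : ∀ {n : ℕ} (h : Hist S n), (M.enabled h.last).Nonempty → PMF A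
  support_subset : ∀ {n : ℕ} (h : Hist S n) (hne : (M.enabled h.last).Nonempty),
    (choice h hne).support ⊆ M.enabled h.last

variable {M}

namespace Scheduler

/-- The decision is deterministic after every history. -/
def IsPure (σ : M.Scheduler) : Prop :=
  ∀ {n : ℕ} (h : Hist S n) (hne : (M.enabled h.last).Nonempty), ∃ a, σ.choice h hne = PMF.pure a

/-- The decision depends on the last state of the history only. -/
def IsPositional (σ : M.Scheduler) : Prop :=
  ∀ {n m : ℕ} (h : Hist S n) (h' : Hist S m) (hne : (M.enabled h.last).Nonempty)
    (hne' : (M.enabled h'.last).Nonempty), h.last = h'.last → σ.choice h hne = σ.choice h' hne'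

open Classical in
/-- The probability that `s'` is the next state after the history `h`:
`∑ₐ σ(h)(a) · P(last h, a, s')`. A path that is at a state without enabled actions (an absorbing
state) stays there forever. -/
def stepWeight (σ : M.Scheduler) {n : ℕ} (h : Hist S n) (s' : S) : ℝ≥0∞ :=
  if hne : (M.enabled h.last).Nonempty then ∑' a, σ.choice h hne a * M.prob h.last a s'
  else if s' = h.last then 1 else 0

theorem tsum_stepWeight (σ : M.Scheduler) {n : ℕ} (h : Hist S n) :
    ∑' s', σ.stepWeight h s' = 1 := by
  classical
  by_cases hne : (M.enabled h.last).Nonempty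
  · simp only [stepWeight, dif_pos hne]
    rw [ENNReal.tsum_comm, ← (σ.choice h hne).tsum_coe]
    refine tsum_congr fun a => ?_
    rw [ENNReal.tsum_mul_left]
    by_cases ha : σ.choice h hne a = 0
    · simp [ha]
    · have hm : a ∈ M.enabled h.last := σ.support_subset h hne ((PMF.mem_support_iff _ _).2 ha)
      rw [show ∑' s', M.prob h.last a s' = 1 from hm, mul_one]
  · simp only [stepWeight, dif_neg hne, tsum_ite_eq]

/-- The distribution of the next state after the history `h`. -/
def step (σ : M.Scheduler) {n : ℕ} (h : Hist S n) : PMF S :=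
  ⟨σ.stepWeight h, ENNReal.summable.hasSum_iff.2 (σ.tsum_stepWeight h)⟩

/-- The distribution of the next state, as a transition kernel from histories to states. -/
def stepKernel [Countable S] (σ : M.Scheduler) (n : ℕ) :
    @ProbabilityTheory.Kernel (Hist S n) S (@MeasurableSpace.pi _ _ (fun _ => ⊤)) ⊤ :=
  letI : MeasurableSpace S := ⊤
  haveI : DiscreteMeasurableSpace S := ⟨fun _ => trivial⟩
  ProbabilityTheory.Kernel.ofFunOfCountable fun h => (σ.step h).toMeasure

/-- The probability measure on paths from `s` under the scheduler `σ`. -/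
def pathMeasure [Countable S] (σ : M.Scheduler) (s : S) :
    @MeasureTheory.Measure (ℕ → S) (pathSpace S) :=
  letI : MeasurableSpace S := ⊤
  haveI : ∀ n, ProbabilityTheory.IsMarkovKernel (σ.stepKernel n) := fun _ =>
    ⟨fun h => PMF.toMeasure.isProbabilityMeasure (σ.step h)⟩
  ProbabilityTheory.Kernel.traj (X := fun _ => S) (fun n => σ.stepKernel n) 0 (fun _ => s)

end Scheduler

variable (M) [Countable S]

/-- The supremum over all schedulers of the probability of the path property `E` from `s`. -/
def supProb (s : S) (E : Set (ℕ → S)) : ℝ≥0∞ := ⨆ σ : M.Scheduler, σ.pathMeasure s E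

/-- The states from which no scheduler reaches `goal` with positive probability. -/
def avoidSup (goal : S) : Set S := {s | M.supProb s (eventuallyIn {goal}) = 0}

/-- sup-decisiveness w.r.t. `goal` from `s`. -/
def SupDecisive (goal s : S) : Prop :=
  ∀ σ : M.Scheduler, σ.IsPure → σ.IsPositional →
    σ.pathMeasure s (eventuallyIn {goal} ∪ eventuallyIn (M.avoidSup goal)) = 1

end MDP

/-! ### Collapsing and slicing -/

open Classical in
/-- The image of a state when everything outside `C` is merged into one fresh state `none`. -/
def mergeCompl {S : Type*} (C : Set S) (s : S) : Option C :=
  if h : s ∈ C then some ⟨s, h⟩ else none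

namespace MDP

variable {S A : Type*} (M : MDP S A)

theorem tsum_split (C : Set S) (f : S → ℝ≥0∞) (g : Option C → ℝ≥0∞)
    (hs : ∀ c : C, g (some c) = f c) (hn : g none = ∑' s : ↥Cᶜ, f s) :
    ∑' x, g x = ∑' s, f s := by
  rw [← (Equiv.optionEquivSumPUnit.{0} C).symm.tsum_eq,
    ENNReal.summable.tsum_sum ENNReal.summable]
  simp only [Equiv.optionEquivSumPUnit_symm_inl, Equiv.optionEquivSumPUnit_symm_inr, hs, hn,
    tsum_fintype, Finset.univ_unique, Finset.sum_singleton]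
  exact ENNReal.summable.tsum_add_tsum_compl (f := f) ENNReal.summable

/-- Transition weights after all states outside `C` are merged into `none`; the outgoing
transitions of `none` are given by `r`. -/
def mergeProb (C : Set S) (r : A → Option C → ℝ≥0∞) : Option C → A → Option C → ℝ≥0∞
  | some s, a, some s' => M.prob s a s'
  | some s, a, none => ∑' s' : ↥Cᶜ, M.prob s a s'
  | none, a, x => r a x

/-- All states outside `C` are merged into a fresh state with a self-loop under every action. -/
def mergeToLoop (C : Set S) : MDP (Option C) A where
  prob := M.mergeProb C fun _ x => if x = none then 1 else 0
  sum_prob := by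
    rintro (_ | s) a
    · right
      simp [mergeProb]
    · rw [tsum_split C (M.prob s a) _ (fun _ => rfl) rfl]
      exact M.sum_prob s a

/-- All states outside `C` are merged into a fresh state without enabled actions. -/
def mergeToDead (C : Set S) : MDP (Option C) A where
  prob := M.mergeProb C fun _ _ => 0
  sum_prob := by
    rintro (_ | s) a
    · left
      simp [mergeProb]
    · rw [tsum_split C (M.prob s a) _ (fun _ => rfl) rfl]
      exact M.sum_prob s a

variable [Countable S]

/-- The state set of the collapsed MDP: the states outside the sup-avoid set of `goal`, and one
fresh state `none` which stands for all the states of the avoid set. -/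
abbrev CollapsedState (goal : S) : Type _ := Option ↥(M.avoidSup goal)ᶜ

/-- The collapsed MDP `M^sup`. -/
def collapsed (goal : S) : MDP (M.CollapsedState goal) A := M.mergeToLoop (M.avoidSup goal)ᶜ

/-- The image of a state of `M` in the collapsed MDP. -/
def toCollapsed (goal s : S) : M.CollapsedState goal := mergeCompl (M.avoidSup goal)ᶜ s

/-- The states of the collapsed MDP that are kept at level `n`: those that can be reached from `s₀`
within `n` steps, the states `goal` and `none` being kept from the start. -/
def sliceSet (goal s₀ : S) : ℕ → Set (M.CollapsedState goal)
  | 0 => {M.toCollapsed goal s₀, M.toCollapsed goal goal, none}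
  | n + 1 => sliceSet goal s₀ n ∪
      {x' | ∃ x ∈ sliceSet goal s₀ n, ∃ a, 0 < (M.collapsed goal).prob x a x'}

/-- The sliced MDP at level `n`: the part of the collapsed MDP on the states kept at level `n`,
with all transitions that leave it redirected to a fresh absorbing state (the outer `none`). -/
def sliced (goal s₀ : S) (n : ℕ) : MDP (Option ↥(M.sliceSet goal s₀ n)) A :=
  (M.collapsed goal).mergeToDead (M.sliceSet goal s₀ n)

/-- The image of a state of `M` in the sliced MDP at level `n`. -/
def toSliced (goal s₀ : S) (n : ℕ) (s : S) : Option ↥(M.sliceSet goal s₀ n) :=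
  mergeCompl (M.sliceSet goal s₀ n) (M.toCollapsed goal s)

/-! ### The approximation schemes -/

/-- `R_n`: the target has been reached within `n` steps, in the collapsed MDP. -/
def reached (goal : S) (n : ℕ) : Set (ℕ → M.CollapsedState goal) :=
  eventuallyWithin n {M.toCollapsed goal goal}

/-- `H_n`: within `n` steps neither the target nor the losing sink of the collapsed MDP has been
visited. -/
def hoping (goal : S) (n : ℕ) : Set (ℕ → M.CollapsedState goal) :=
  alwaysWithin n {M.toCollapsed goal goal, none}ᶜ

/-- Lower bound of the first scheme. -/
def lower₁ (goal s₀ : S) (n : ℕ) : ℝ :=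
  ((M.collapsed goal).supProb (M.toCollapsed goal s₀) (M.reached goal n)).toReal

/-- Upper bound of the first scheme. -/
def upper₁ (goal s₀ : S) (n : ℕ) : ℝ :=
  ((M.collapsed goal).supProb (M.toCollapsed goal s₀)
    (M.reached goal n ∪ M.hoping goal n)).toReal

/-- Lower bound of the second scheme. -/
def lower₂ (goal s₀ : S) (n : ℕ) : ℝ :=
  ((M.sliced goal s₀ n).supProb (M.toSliced goal s₀ n s₀)
    (eventuallyIn {M.toSliced goal s₀ n goal})).toReal

/-- Upper bound of the second scheme. -/
def upper₂ (goal s₀ : S) (n : ℕ) : ℝ :=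
  ((M.sliced goal s₀ n).supProb (M.toSliced goal s₀ n s₀)
    (eventuallyIn {M.toSliced goal s₀ n goal, none})).toReal

end MDP

open Classical in
/-- The program `n := 0; repeat n := n + 1 until |hi n - lo n| ≤ ε; return lo n`. It is a partial
value: its domain is the termination of the loop, its value the number that is returned. -/
def repeatUntilClose (lo hi : ℕ → ℝ) (ε : ℝ) : Part ℝ :=
  ⟨∃ n, 1 ≤ n ∧ |hi n - lo n| ≤ ε, fun h => lo (Nat.find h)⟩

/-- The program above terminates for every precision `ε > 0` and is correct for the value `p`: at
every stage `p` lies between the bounds, and the returned number is a number of `[0,1]` which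
approximates `p` up to `ε`. -/
def TerminatesAndCorrect (lo hi : ℕ → ℝ) (p : ℝ) : Prop :=
  (∀ n, lo n ≤ p ∧ p ≤ hi n) ∧
  ∀ ε, 0 < ε → (repeatUntilClose lo hi ε).Dom ∧
    ∀ v ∈ repeatUntilClose lo hi ε, v ∈ Set.Icc (0 : ℝ) 1 ∧ |v - p| ≤ ε

end

/-!
All suprema over schedulers are computed by Bellman iteration. For a stop set `D` and a set `U` let
`bellmanValue D U n s` be the value with horizon `n` of the game that stops at `D` and pays the
indicator of `U`. Along any scheduler the payoff of the stopped path, with a function of the current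
state as terminal payoff, increases (decreases) in expectation if that function is a sub- (super-)
solution of the Bellman equations. This yields upper bounds for all schedulers
(`MDP.pathMeasure_stoppedIn_le_of_bellman`) and, through schedulers that take good actions, lower
bounds (`MDP.le_supProb_stoppedIn`). Since there are finitely many actions, the reachability value
of `s` is the increasing limit of the values with finite horizons
(`MDP.supProb_eventuallyIn_eq_iSup`), and it is enough to compare those in the original, the
collapsed and the sliced MDP; collapsing changes nothing, because the avoid set consists of the
states whose values all vanish.

The point of the theorem is that the values `Y n` of surviving `n` steps outside the target and the
avoid set tend to `0` at the initial state. They decrease to some `V`, and as there are finitely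
many actions, in each state some action `a` satisfies `V s ≤ ∑' s', P s a s' * V s'`
(`MDP.exists_iInf_bellmanValue_le_tsum_mul`). Always taking such an action is a pure positional
scheduler under which the path survives forever with probability at least `V s₀`; by decisiveness
this probability is `0` (`MDP.tendsto_bellmanValue_compl_of_supDecisive`).

The gap between the bounds of either scheme is at most `Y n s₀`: for the first scheme by the union
bound, for the second one since the fresh state is not reachable within `n` steps
(`MDP.sliced_pathMeasure_none_first_le`). As the bounds enclose the exact value, both schemes
terminate and are correct.
-/

/-! ### Integrating along trajectories -/

section Trajectory

open MeasureTheory ProbabilityTheory Finset Preorder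

/-- The law of coordinate `k + 1`, given the coordinates up to `k`, is the kernel `κ k`. -/
theorem lintegral_traj_succ {X : ℕ → Type*} [∀ n, MeasurableSpace (X n)]
    (κ : (n : ℕ) → Kernel ((i : Iic n) → X i) (X (n + 1))) [∀ n, IsMarkovKernel (κ n)]
    (x₀ : (i : Iic 0) → X i) (k : ℕ) (F : ((i : Iic k) → X i) → X (k + 1) → ℝ≥0∞)
    (hF : Measurable (Function.uncurry F)) :
    ∫⁻ ρ, F (frestrictLe k ρ) (ρ (k + 1)) ∂(Kernel.traj κ 0 x₀) =
      ∫⁻ ρ, ∫⁻ y, F (frestrictLe k ρ) y ∂(κ k (frestrictLe k ρ)) ∂(Kernel.traj κ 0 x₀) := by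
  have hG : Measurable fun h => ∫⁻ y, F h y ∂(κ k h) := hF.lintegral_kernel_prod_right'
  have hF' : Measurable fun h : (i : Iic (k + 1)) → X i =>
      F (frestrictLe₂ k.le_succ h) (h ⟨k + 1, mem_Iic.2 le_rfl⟩) :=
    hF.comp ((measurable_frestrictLe₂ k.le_succ).prodMk (measurable_pi_apply _))
  have h1 := lintegral_map (μ := Kernel.traj κ 0 x₀) hF' (measurable_frestrictLe (k + 1))
  have h2 := lintegral_map (μ := Kernel.traj κ 0 x₀) hG (measurable_frestrictLe k)
  rw [Kernel.traj_map_frestrictLe_apply] at h1 h2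
  refine h1.symm.trans (Eq.trans ?_ h2)
  rw [Kernel.partialTraj_succ_eq_comp (Nat.zero_le k), Kernel.lintegral_comp _ _ _ hF']
  refine lintegral_congr fun h => ?_
  rw [Kernel.partialTraj_succ_self, Kernel.lintegral_map _ measurable_IicProdIoc _ hF',
    Kernel.lintegral_id_prod, Kernel.lintegral_map]
  · refine lintegral_congr fun y => ?_
    congr 1
    · ext i
      have hi := mem_Iic.1 i.2
      simp [frestrictLe₂, IicProdIoc, hi]
    · simp [IicProdIoc, MeasurableEquiv.piSingleton]
  · exact (MeasurableEquiv.piSingleton k).measurable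
  · exact hF'.comp (measurable_IicProdIoc.comp measurable_prodMk_left)
  · exact hF'.comp measurable_IicProdIoc

end Trajectory

/-! ### Stopped paths -/

open Classical in
/-- The payoff of the path `ρ` when it is stopped at its first visit to `D`: if that visit is at a
time before `k`, the payoff is `1` or `0` according to whether the visited state is in `U`;
otherwise it is the terminal payoff `x`. -/
noncomputable def stoppedPayoff {S : Type*} (D U : Set S) (ρ : ℕ → S) : ℕ → ℝ≥0∞ → ℝ≥0∞
  | 0, x => x
  | k + 1, x => stoppedPayoff D U ρ k (if ρ k ∈ D then U.indicator 1 (ρ k) else x)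

/-- The path is stopped in `U`, when stopping means to stop at the first visit to `D`, or at time
`n` if that is earlier. -/
def stoppedIn {S : Type*} (D U : Set S) (n : ℕ) : Set (ℕ → S) :=
  {ρ | ∃ k ≤ n, ρ k ∈ U ∧ (∀ j < k, ρ j ∉ D) ∧ (ρ k ∈ D ∨ k = n)}

section StoppedPayoff

variable {S : Type*} {D U : Set S} {ρ ρ' : ℕ → S}

theorem stoppedPayoff_mono (k : ℕ) : Monotone (stoppedPayoff D U ρ k) := by
  induction k with
  | zero => exact monotone_id
  | succ k ih =>
    intro x y hxy
    simp only [stoppedPayoff]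
    apply ih
    split_ifs
    exacts [le_rfl, hxy]

theorem stoppedPayoff_congr (k : ℕ) (h : ∀ i < k, ρ i = ρ' i) (x : ℝ≥0∞) :
    stoppedPayoff D U ρ k x = stoppedPayoff D U ρ' k x := by
  induction k generalizing x with
  | zero => rfl
  | succ k ih =>
    simp only [stoppedPayoff]
    rw [ih (fun i hi => h i (hi.trans k.lt_succ_self)), h k k.lt_succ_self]

/-- The stopped payoff is affine in the terminal payoff, so it commutes with averaging. -/
theorem tsum_mul_stoppedPayoff (w : S → ℝ≥0∞) (hw : ∑' s, w s = 1) (k : ℕ) (f : S → ℝ≥0∞) :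
    ∑' s, w s * stoppedPayoff D U ρ k (f s) = stoppedPayoff D U ρ k (∑' s, w s * f s) := by
  induction k generalizing f with
  | zero => rfl
  | succ k ih =>
    classical
    simp only [stoppedPayoff]
    rw [ih fun s => if ρ k ∈ D then U.indicator 1 (ρ k) else f s]
    congr 1
    split_ifs
    · rw [ENNReal.tsum_mul_right, hw, one_mul]
    · rfl

theorem stoppedPayoff_of_forall_notMem (k : ℕ) (h : ∀ j < k, ρ j ∉ D) (x : ℝ≥0∞) :
    stoppedPayoff D U ρ k x = x := by
  induction k generalizing x with
  | zero => rfl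
  | succ k ih =>
    simp only [stoppedPayoff]
    rw [ih fun j hj => h j (hj.trans k.lt_succ_self), if_neg (h k k.lt_succ_self)]

theorem stoppedPayoff_of_first_visit {j k : ℕ} (hjk : j < k) (hj : ρ j ∈ D)
    (h : ∀ i < j, ρ i ∉ D) (x : ℝ≥0∞) : stoppedPayoff D U ρ k x = U.indicator 1 (ρ j) := by
  induction k generalizing x with
  | zero => omega
  | succ k ih =>
    simp only [stoppedPayoff]
    rcases (Nat.lt_succ_iff.1 hjk).eq_or_lt with rfl | hlt
    · rw [stoppedPayoff_of_forall_notMem _ h, if_pos hj]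
    · exact ih hlt _

theorem stoppedPayoff_eq_indicator (n : ℕ) (ρ : ℕ → S) :
    stoppedPayoff D U ρ n (U.indicator 1 (ρ n)) = (stoppedIn D U n).indicator 1 ρ := by
  classical
  -- `j` is the time at which the path is stopped.
  obtain ⟨j, hjn, hjD, hj⟩ : ∃ j ≤ n, (ρ j ∈ D ∨ j = n) ∧ ∀ i < j, ρ i ∉ D := by
    have hex : ∃ j, ρ j ∈ D ∨ j = n := ⟨n, Or.inr rfl⟩
    refine ⟨Nat.find hex, Nat.find_min' hex (Or.inr rfl), Nat.find_spec hex, fun i hi hD => ?_⟩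
    exact Nat.find_min hex hi (Or.inl hD)
  have h1 : stoppedPayoff D U ρ n (U.indicator 1 (ρ n)) = U.indicator 1 (ρ j) := by
    rcases hjn.eq_or_lt with rfl | hlt
    · exact stoppedPayoff_of_forall_notMem _ hj _
    · exact stoppedPayoff_of_first_visit hlt (hjD.resolve_right hlt.ne) hj _
  have h2 : ρ ∈ stoppedIn D U n ↔ ρ j ∈ U := by
    refine ⟨?_, fun h => ⟨j, hjn, h, hj, hjD⟩⟩
    rintro ⟨k, hkn, hkU, hk, hkD⟩
    obtain rfl : k = j := by
      rcases lt_trichotomy k j with h | h | h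
      · rcases hkD with h' | rfl
        · exact absurd h' (hj k h)
        · omega
      · exact h
      · rcases hjD with h' | rfl
        · exact absurd h' (hk j h)
        · omega
    exact hkU
  rw [h1]
  by_cases h : ρ j ∈ U <;> simp [Set.indicator, h, h2]

end StoppedPayoff

attribute [local instance] pathSpace

section PathEvents

variable {S : Type*}

theorem measurableSet_coordinate (k : ℕ) (T : Set S) : MeasurableSet {ρ : ℕ → S | ρ k ∈ T} :=
  let : MeasurableSpace S := ⊤
  measurable_pi_apply k (MeasurableSpace.measurableSet_top (s := T))

theorem measurableSet_stoppedIn (D U : Set S) (n : ℕ) : MeasurableSet (stoppedIn D U n) := by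
  have : stoppedIn D U n = ⋃ k : ℕ, ⋃ _ : k ≤ n, {ρ | ρ k ∈ U} ∩
      ((⋂ j : ℕ, ⋂ _ : j < k, {ρ | ρ j ∈ Dᶜ}) ∩ ({ρ | ρ k ∈ D} ∪ {_ρ | k = n})) := by
    ext ρ
    simp only [stoppedIn, Set.mem_iUnion, Set.mem_iInter, Set.mem_inter_iff, Set.mem_union,
      Set.mem_ofPred_eq, Set.mem_compl_iff, exists_prop]
  rw [this]
  exact .iUnion fun k => .iUnion fun _ => (measurableSet_coordinate k U).inter
    ((MeasurableSet.iInter fun j => .iInter fun _ => measurableSet_coordinate j Dᶜ).inter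
      ((measurableSet_coordinate k D).union (.const _)))

end PathEvents

/-! ### Sub- and supersolutions of the Bellman equations -/

namespace MDP

variable {S A : Type*} [Countable S] {M : MDP S A}

open MeasureTheory ProbabilityTheory Preorder

namespace Scheduler

instance isMarkovKernel_stepKernel (σ : M.Scheduler) (n : ℕ) :
    letI : MeasurableSpace S := ⊤
    IsMarkovKernel (σ.stepKernel n) :=
  let : MeasurableSpace S := ⊤
  ⟨fun h => PMF.toMeasure.isProbabilityMeasure (σ.step h)⟩

instance isProbabilityMeasure_pathMeasure (σ : M.Scheduler) (s : S) :
    IsProbabilityMeasure (σ.pathMeasure s) := by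
  let : MeasurableSpace S := ⊤
  unfold pathMeasure
  infer_instance

theorem lintegral_pathMeasure_zero (σ : M.Scheduler) (s : S) (f : S → ℝ≥0∞) :
    ∫⁻ ρ, f (ρ 0) ∂(σ.pathMeasure s) = f s := by
  let : MeasurableSpace S := ⊤
  have hf : Measurable fun h : Hist S 0 => f h.last :=
    (measurable_from_top (f := f)).comp (measurable_pi_apply _)
  have h1 := lintegral_map (μ := σ.pathMeasure s) hf (measurable_frestrictLe 0)
  unfold pathMeasure at h1 ⊢
  rw [Kernel.traj_map_frestrictLe_apply, Kernel.partialTraj_self, Kernel.id_apply,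
    lintegral_dirac' _ hf] at h1
  exact h1.symm

/-- One step of the path distribution: given the history up to time `k`, the state number `k + 1`
has the distribution `σ.stepWeight`. -/
theorem lintegral_pathMeasure_succ (σ : M.Scheduler) (s : S) (k : ℕ)
    (F : (ℕ → S) → S → ℝ≥0∞) (hF : ∀ ρ ρ', (∀ i ≤ k, ρ i = ρ' i) → F ρ = F ρ') :
    ∫⁻ ρ, F ρ (ρ (k + 1)) ∂(σ.pathMeasure s) =
      ∫⁻ ρ, ∑' s', σ.stepWeight (frestrictLe k ρ) s' * F ρ s' ∂(σ.pathMeasure s) := by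
  let : MeasurableSpace S := ⊤
  have : DiscreteMeasurableSpace S := ⟨fun _ => trivial⟩
  -- Extend a history to a path by repeating its last state; `F` does not see the difference.
  let ext : Hist S k → ℕ → S := fun h i => h ⟨min i k, Finset.mem_Iic.2 (min_le_right i k)⟩
  have hext : ∀ ρ : ℕ → S, F (ext (frestrictLe k ρ)) = F ρ := fun ρ =>
    hF _ _ fun i hi => by simp [ext, min_eq_left hi]
  have key := lintegral_traj_succ (X := fun _ => S) (fun n => σ.stepKernel n) (fun _ => s) k
    (fun h => F (ext h)) (Measurable.of_discrete)
  simp only [hext] at key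
  unfold pathMeasure
  refine key.trans (lintegral_congr fun ρ => ?_)
  rw [lintegral_countable']
  refine tsum_congr fun s' => ?_
  rw [mul_comm]
  congr 1
  exact PMF.toMeasure_apply_singleton _ _ (measurableSet_singleton s')

/-- Moving the terminal payoff one step back in time. -/
theorem lintegral_stoppedPayoff_succ (σ : M.Scheduler) (s : S) (D U : Set S) (k : ℕ)
    (f : S → ℝ≥0∞) :
    ∫⁻ ρ, stoppedPayoff D U ρ (k + 1) (f (ρ (k + 1))) ∂(σ.pathMeasure s) =
      ∫⁻ ρ, stoppedPayoff D U ρ (k + 1)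
        (∑' s', σ.stepWeight (frestrictLe k ρ) s' * f s') ∂(σ.pathMeasure s) := by
  rw [lintegral_pathMeasure_succ σ s k fun ρ s' => stoppedPayoff D U ρ (k + 1) (f s')]
  · exact lintegral_congr fun ρ => tsum_mul_stoppedPayoff _ (σ.tsum_stepWeight _) _ _
  · intro ρ ρ' h
    ext s'
    exact stoppedPayoff_congr _ (fun i hi => h i (Nat.lt_succ_iff.1 hi)) _

theorem lintegral_stoppedPayoff_indicator (σ : M.Scheduler) (s : S) (D U : Set S) (n : ℕ) :
    ∫⁻ ρ, stoppedPayoff D U ρ n (U.indicator 1 (ρ n)) ∂(σ.pathMeasure s) =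
      σ.pathMeasure s (stoppedIn D U n) := by
  simp only [stoppedPayoff_eq_indicator]
  exact lintegral_indicator_one (measurableSet_stoppedIn D U n)

/-- A subsolution of the Bellman equations along `σ` is a lower bound: it makes the expected
stopped payoff increase with the horizon. -/
theorem le_pathMeasure_stoppedIn (σ : M.Scheduler) (s : S) {D U : Set S} {n : ℕ}
    {f : ℕ → S → ℝ≥0∞} (hterm : ∀ s', f n s' ≤ U.indicator 1 s')
    (hvisit : ∀ k < n, ∀ s' ∈ D, f k s' ≤ U.indicator 1 s')
    (hstep : ∀ k < n, ∀ h : Hist S k, h.last ∉ D →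
      f k h.last ≤ ∑' s', σ.stepWeight h s' * f (k + 1) s') :
    f 0 s ≤ σ.pathMeasure s (stoppedIn D U n) := by
  have main : ∀ k ≤ n, f 0 s ≤ ∫⁻ ρ, stoppedPayoff D U ρ k (f k (ρ k)) ∂(σ.pathMeasure s) := by
    intro k
    induction k with
    | zero => exact fun _ => (σ.lintegral_pathMeasure_zero s (f 0)).ge
    | succ k ih =>
      intro hk
      refine (ih (by omega)).trans ?_
      rw [lintegral_stoppedPayoff_succ]
      refine lintegral_mono fun ρ => stoppedPayoff_mono k ?_
      split_ifs with hD
      · exact hvisit k hk _ hD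
      · exact hstep k hk (frestrictLe k ρ) hD
  rw [← lintegral_stoppedPayoff_indicator]
  exact (main n le_rfl).trans (lintegral_mono fun ρ => stoppedPayoff_mono n (hterm _))

/-- A supersolution of the Bellman equations along `σ` is an upper bound. -/
theorem pathMeasure_stoppedIn_le (σ : M.Scheduler) (s : S) {D U : Set S} {n : ℕ}
    {f : ℕ → S → ℝ≥0∞} (hterm : ∀ s', U.indicator 1 s' ≤ f n s')
    (hvisit : ∀ k < n, ∀ s' ∈ D, U.indicator 1 s' ≤ f k s')
    (hstep : ∀ k < n, ∀ h : Hist S k, h.last ∉ D →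
      ∑' s', σ.stepWeight h s' * f (k + 1) s' ≤ f k h.last) :
    σ.pathMeasure s (stoppedIn D U n) ≤ f 0 s := by
  have main : ∀ k ≤ n, ∫⁻ ρ, stoppedPayoff D U ρ k (f k (ρ k)) ∂(σ.pathMeasure s) ≤ f 0 s := by
    intro k
    induction k with
    | zero => exact fun _ => (σ.lintegral_pathMeasure_zero s (f 0)).le
    | succ k ih =>
      intro hk
      refine le_trans ?_ (ih (by omega))
      rw [lintegral_stoppedPayoff_succ]
      refine lintegral_mono fun ρ => stoppedPayoff_mono k ?_
      split_ifs with hD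
      · exact hvisit k hk _ hD
      · exact hstep k hk (frestrictLe k ρ) hD
  rw [← lintegral_stoppedPayoff_indicator]
  exact (lintegral_mono fun ρ => stoppedPayoff_mono n (hterm _)).trans (main n le_rfl)

end Scheduler

end MDP

/-! ### Path properties as stopping events -/

section PathEvents

variable {S : Type*}

theorem stoppedIn_self (T : Set S) (n : ℕ) : stoppedIn T T n = eventuallyWithin n T := by
  classical
  ext ρ
  constructor
  · rintro ⟨k, hkn, hk, -⟩
    exact ⟨k, hkn, hk⟩
  · rintro ⟨k, hkn, hk⟩
    have hex : ∃ j, ρ j ∈ T := ⟨k, hk⟩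
    exact ⟨Nat.find hex, (Nat.find_min' hex hk).trans hkn, Nat.find_spec hex,
      fun j hj => Nat.find_min hex hj, Or.inl (Nat.find_spec hex)⟩

theorem stoppedIn_compl (D : Set S) (n : ℕ) : stoppedIn D Dᶜ n = alwaysWithin n Dᶜ := by
  ext ρ
  constructor
  · rintro ⟨k, -, hkD, hk, h⟩ j hj
    obtain rfl := h.resolve_left hkD
    rcases hj.eq_or_lt with rfl | hlt
    exacts [hkD, hk j hlt]
  · exact fun h => ⟨n, le_rfl, h n le_rfl, fun j hj => h j hj.le, Or.inr rfl⟩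

theorem eventuallyIn_eq_iUnion (T : Set S) : eventuallyIn T = ⋃ n, eventuallyWithin n T := by
  ext ρ
  simp only [eventuallyIn, eventuallyWithin, Set.mem_iUnion, Set.mem_ofPred_eq]
  exact ⟨fun ⟨k, hk⟩ => ⟨k, k, le_rfl, hk⟩, fun ⟨_, k, _, hk⟩ => ⟨k, hk⟩⟩

theorem monotone_eventuallyWithin (T : Set S) : Monotone fun n => eventuallyWithin n T :=
  fun _ _ hmn _ ⟨k, hk, hT⟩ => ⟨k, hk.trans hmn, hT⟩

theorem measurableSet_eventuallyIn (T : Set S) : MeasurableSet (eventuallyIn T) := by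
  rw [eventuallyIn, Set.ofPred_exists]
  exact .iUnion fun k => measurableSet_coordinate k T

end PathEvents

namespace MDP

variable {S A : Type*} {M : MDP S A}

/-! ### Schedulers given by preferences -/

open Classical in
/-- The pure Markov scheduler that, at step `n` in state `s`, takes an enabled action `a` with
`good n s a` whenever there is one. -/
noncomputable def Scheduler.ofPreference (M : MDP S A) (good : ℕ → S → A → Prop) :
    M.Scheduler where
  choice {n} h hne := PMF.pure <|
    if e : ∃ a ∈ M.enabled h.last, good n h.last a then e.choose else hne.some
  support_subset {n} h hne := by
    rw [PMF.support_pure, Set.singleton_subset_iff]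
    split_ifs with e
    exacts [e.choose_spec.1, hne.some_mem]

theorem Scheduler.isPure_ofPreference (good : ℕ → S → A → Prop) :
    (ofPreference M good).IsPure := fun _ _ => ⟨_, rfl⟩

theorem Scheduler.isPositional_ofPreference (good : S → A → Prop) :
    (ofPreference M fun _ => good).IsPositional := by
  intro n m h h'
  simp only [ofPreference]
  generalize h.last = x
  generalize h'.last = y
  rintro hne hne' rfl
  rfl

theorem Scheduler.exists_stepWeight_ofPreference {good : ℕ → S → A → Prop} {n : ℕ}
    (h : Hist S n) (e : ∃ a ∈ M.enabled h.last, good n h.last a) :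
    ∃ a, good n h.last a ∧ ∀ s', (ofPreference M good).stepWeight h s' = M.prob h.last a s' := by
  refine ⟨e.choose, e.choose_spec.2, fun s' => ?_⟩
  rw [stepWeight, dif_pos ⟨_, e.choose_spec.1⟩, tsum_eq_single e.choose]
  · simp [ofPreference, e]
  · intro a ha
    simp [ofPreference, e, ha]

variable [Countable S]

open MeasureTheory

/-- If in every state outside `D` with `f k s ≠ 0` some good action satisfies the Bellman
inequality for `f`, then a scheduler that takes good actions achieves at least the value `f 0`. -/
theorem le_pathMeasure_ofPreference (s : S) {D U : Set S} {n : ℕ} {f : ℕ → S → ℝ≥0∞}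
    {good : ℕ → S → A → Prop}
    (hgood : ∀ k < n, ∀ s a, good k s a → f k s ≤ ∑' s', M.prob s a s' * f (k + 1) s')
    (hterm : ∀ s', f n s' ≤ U.indicator 1 s')
    (hvisit : ∀ k < n, ∀ s' ∈ D, f k s' ≤ U.indicator 1 s')
    (hstep : ∀ k < n, ∀ s ∉ D, f k s ≠ 0 → ∃ a ∈ M.enabled s, good k s a) :
    f 0 s ≤ (Scheduler.ofPreference M good).pathMeasure s (stoppedIn D U n) := by
  refine Scheduler.le_pathMeasure_stoppedIn _ s hterm hvisit fun k hk h hD => ?_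
  by_cases h0 : f k h.last = 0
  · simp [h0]
  obtain ⟨a, ha, hw⟩ := Scheduler.exists_stepWeight_ofPreference h (hstep k hk _ hD h0)
  simp only [hw]
  exact hgood k hk _ a ha

/-- A subsolution of the optimal Bellman equations is a lower bound for the optimal
probability. -/
theorem le_supProb_stoppedIn (s : S) {D U : Set S} {n : ℕ} {f : ℕ → S → ℝ≥0∞}
    (hterm : ∀ s', f n s' ≤ U.indicator 1 s')
    (hvisit : ∀ k < n, ∀ s' ∈ D, f k s' ≤ U.indicator 1 s')
    (hstep : ∀ k < n, ∀ s ∉ D, f k s ≠ 0 →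
      ∃ a ∈ M.enabled s, f k s ≤ ∑' s', M.prob s a s' * f (k + 1) s') :
    f 0 s ≤ M.supProb s (stoppedIn D U n) :=
  (le_pathMeasure_ofPreference s (fun _ _ _ _ => id) hterm hvisit hstep).trans
    (le_iSup (fun σ : M.Scheduler => σ.pathMeasure s (stoppedIn D U n)) _)

/-- A supersolution of the optimal Bellman equations is an upper bound for every scheduler. -/
theorem pathMeasure_stoppedIn_le_of_bellman (σ : M.Scheduler) (s : S) {D U : Set S} {n : ℕ}
    {f : ℕ → S → ℝ≥0∞} (hterm : ∀ s', U.indicator 1 s' ≤ f n s')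
    (hvisit : ∀ k < n, ∀ s' ∈ D, U.indicator 1 s' ≤ f k s')
    (hstep : ∀ k < n, ∀ s ∉ D, ∀ a ∈ M.enabled s, ∑' s', M.prob s a s' * f (k + 1) s' ≤ f k s)
    (hdead : ∀ k < n, ∀ s ∉ D, ¬ (M.enabled s).Nonempty → f (k + 1) s ≤ f k s) :
    σ.pathMeasure s (stoppedIn D U n) ≤ f 0 s := by
  refine σ.pathMeasure_stoppedIn_le s hterm hvisit fun k hk h hD => ?_
  by_cases hne : (M.enabled h.last).Nonempty
  · simp only [Scheduler.stepWeight, dif_pos hne, ← ENNReal.tsum_mul_right]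
    rw [ENNReal.tsum_comm]
    calc ∑' a, ∑' s', σ.choice h hne a * M.prob h.last a s' * f (k + 1) s'
        ≤ ∑' a, σ.choice h hne a * f k h.last := by
          refine ENNReal.tsum_le_tsum fun a => ?_
          simp only [mul_assoc]
          rw [ENNReal.tsum_mul_left]
          by_cases ha : σ.choice h hne a = 0
          · simp [ha]
          · gcongr
            exact hstep k hk _ hD a (σ.support_subset h hne ((PMF.mem_support_iff _ _).2 ha))
      _ = f k h.last := by rw [ENNReal.tsum_mul_right, PMF.tsum_coe, one_mul]
  · simp only [Scheduler.stepWeight, dif_neg hne, ite_mul, one_mul, zero_mul, tsum_ite_eq]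
    exact hdead k hk _ hD hne

theorem supProb_le_one (s : S) (E : Set (ℕ → S)) : M.supProb s E ≤ 1 :=
  iSup_le fun _ => prob_le_one

theorem supProb_mono (s : S) {E E' : Set (ℕ → S)} (h : E ⊆ E') :
    M.supProb s E ≤ M.supProb s E' :=
  iSup_mono fun _ => measure_mono h

theorem supProb_union_le (s : S) (E E' : Set (ℕ → S)) :
    M.supProb s (E ∪ E') ≤ M.supProb s E + M.supProb s E' :=
  iSup_le fun σ => (measure_union_le _ _).trans (add_le_add
    (le_iSup (fun σ : M.Scheduler => σ.pathMeasure s E) σ)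
    (le_iSup (fun σ : M.Scheduler => σ.pathMeasure s E') σ))

theorem supProb_eventuallyIn (s : S) (T : Set S) :
    M.supProb s (eventuallyIn T) = ⨆ n, M.supProb s (eventuallyWithin n T) := by
  simp only [supProb]
  rw [iSup_comm]
  refine iSup_congr fun σ => ?_
  rw [eventuallyIn_eq_iUnion, (monotone_eventuallyWithin T).measure_iUnion]

end MDP

/-! ### Bellman iteration -/

namespace MDP

variable {S A : Type*} {M : MDP S A}

open Classical in
/-- Bellman iteration: the optimal expected payoff with horizon `n` when paths are stopped at `D`
and the payoff is the indicator of `U`. Outside `D`, a state without enabled actions gets the value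
`0` at positive horizons; this is its optimal payoff only if it is not in `U`. -/
noncomputable def bellmanValue (M : MDP S A) (D U : Set S) : ℕ → S → ℝ≥0∞
  | 0, s => U.indicator 1 s
  | n + 1, s => if s ∈ D then U.indicator 1 s
      else ⨆ a ∈ M.enabled s, ∑' s', M.prob s a s' * bellmanValue M D U n s'

section BellmanValue

variable {D U : Set S} {s : S}

theorem bellmanValue_of_mem (hs : s ∈ D) (n : ℕ) :
    M.bellmanValue D U n s = U.indicator 1 s := by
  cases n <;> simp [bellmanValue, hs]

theorem bellmanValue_succ_of_notMem (hs : s ∉ D) (n : ℕ) :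
    M.bellmanValue D U (n + 1) s =
      ⨆ a ∈ M.enabled s, ∑' s', M.prob s a s' * M.bellmanValue D U n s' := by
  simp [bellmanValue, hs]

theorem bellmanValue_of_not_nonempty (hne : ¬ (M.enabled s).Nonempty) (hU : s ∉ U) (n : ℕ) :
    M.bellmanValue D U n s = 0 := by
  rw [Set.not_nonempty_iff_eq_empty] at hne
  cases n <;> simp [bellmanValue, hU, hne]

theorem tsum_mul_le_bellmanValue (hs : s ∉ D) {a : A} (ha : a ∈ M.enabled s) (n : ℕ) :
    ∑' s', M.prob s a s' * M.bellmanValue D U n s' ≤ M.bellmanValue D U (n + 1) s := by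
  rw [bellmanValue_succ_of_notMem hs]
  exact le_iSup₂ (f := fun a (_ : a ∈ M.enabled s) =>
    ∑' s', M.prob s a s' * M.bellmanValue D U n s') a ha

theorem exists_bellmanValue_le_tsum_mul (hfin : (M.enabled s).Finite) (hs : s ∉ D) {n : ℕ}
    (h0 : M.bellmanValue D U (n + 1) s ≠ 0) :
    ∃ a ∈ M.enabled s,
      M.bellmanValue D U (n + 1) s ≤ ∑' s', M.prob s a s' * M.bellmanValue D U n s' := by
  have hne : (M.enabled s).Nonempty := by
    by_contra hne
    rw [Set.not_nonempty_iff_eq_empty] at hne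
    exact h0 (by simp [bellmanValue_succ_of_notMem hs, hne])
  obtain ⟨a, ha, hmax⟩ := Set.exists_max_image _
    (fun a => ∑' s', M.prob s a s' * M.bellmanValue D U n s') hfin hne
  refine ⟨a, ha, ?_⟩
  rw [bellmanValue_succ_of_notMem hs]
  exact iSup₂_le hmax

theorem indicator_one_le_one (U : Set S) (s : S) : U.indicator (1 : S → ℝ≥0∞) s ≤ 1 :=
  Set.indicator_le_self' (fun _ _ => zero_le_one) s

theorem tsum_prob_mul_le_of_le (s : S) (a : A) {f : S → ℝ≥0∞} {c : ℝ≥0∞} (hf : ∀ s', f s' ≤ c) :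
    ∑' s', M.prob s a s' * f s' ≤ c := by
  calc ∑' s', M.prob s a s' * f s' ≤ ∑' s', M.prob s a s' * c :=
        ENNReal.tsum_le_tsum fun s' => by gcongr; exact hf s'
    _ = (∑' s', M.prob s a s') * c := ENNReal.tsum_mul_right
    _ ≤ c := by rcases M.sum_prob s a with h | h <;> simp [h]

theorem bellmanValue_le_one (n : ℕ) (s : S) : M.bellmanValue D U n s ≤ 1 := by
  induction n generalizing s with
  | zero => exact indicator_one_le_one U s
  | succ n ih =>
    by_cases hs : s ∈ D
    · rw [bellmanValue_of_mem hs]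
      exact indicator_one_le_one U s
    · rw [bellmanValue_succ_of_notMem hs]
      exact iSup₂_le fun a _ => tsum_prob_mul_le_of_le s a ih

theorem bellmanValue_succ_mono {n m : ℕ}
    (h : ∀ s, M.bellmanValue D U n s ≤ M.bellmanValue D U m s) (s : S) :
    M.bellmanValue D U (n + 1) s ≤ M.bellmanValue D U (m + 1) s := by
  by_cases hs : s ∈ D
  · simp only [bellmanValue_of_mem hs, le_refl]
  · simp only [bellmanValue_succ_of_notMem hs]
    gcongr with a ha s'
    exact h s'

theorem monotone_bellmanValue (hUD : U ⊆ D) : Monotone (M.bellmanValue D U) := by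
  refine monotone_nat_of_le_succ fun n => ?_
  induction n with
  | zero =>
    intro s
    by_cases hs : s ∈ D
    · simp only [bellmanValue_of_mem hs, le_refl]
    · rw [bellmanValue, Set.indicator_of_notMem fun h => hs (hUD h)]
      exact zero_le
  | succ n ih => exact bellmanValue_succ_mono ih

theorem antitone_bellmanValue_compl : Antitone (M.bellmanValue D Dᶜ) := by
  refine antitone_nat_of_succ_le fun n => ?_
  induction n with
  | zero =>
    intro s
    by_cases hs : s ∈ D
    · simp only [bellmanValue_of_mem hs, le_refl]
    · rw [show M.bellmanValue D Dᶜ 0 s = 1 by simp [bellmanValue, hs]]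
      exact bellmanValue_le_one _ s
  | succ n ih => exact bellmanValue_succ_mono ih

open MeasureTheory in
theorem tsum_mul_iInf_eq (w : S → ℝ≥0∞) (hw : ∑' s, w s ≠ ∞) {f : ℕ → S → ℝ≥0∞}
    (hf : Antitone f) (hf1 : ∀ s, f 0 s ≤ 1) :
    ∑' s, w s * ⨅ n, f n s = ⨅ n, ∑' s, w s * f n s := by
  let : MeasurableSpace S := ⊤
  have hint : ∀ g : S → ℝ≥0∞,
      ∑' s, w s * g s = ∫⁻ s, g s ∂(Measure.sum fun s => w s • Measure.dirac s) := fun g => by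
    simp [lintegral_sum_measure, lintegral_dirac' _ (measurable_from_top (f := g))]
  simp only [hint]
  refine lintegral_iInf (fun _ => measurable_from_top) hf ?_
  rw [← hint]
  refine ne_top_of_le_ne_top hw (ENNReal.tsum_le_tsum fun s => ?_)
  exact mul_le_of_le_one_right' (hf1 s)

/-- With finitely many actions, the infimum of the decreasing survival values is again attained
by one action in the Bellman equation. -/
theorem exists_iInf_bellmanValue_le_tsum_mul (hfin : (M.enabled s).Finite) (hs : s ∉ D)
    (h0 : ⨅ n, M.bellmanValue D Dᶜ n s ≠ 0) :
    ∃ a ∈ M.enabled s, ⨅ n, M.bellmanValue D Dᶜ n s ≤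
      ∑' s', M.prob s a s' * ⨅ n, M.bellmanValue D Dᶜ n s' := by
  by_contra! hlt
  have hN : ∀ a, ∃ N, a ∈ M.enabled s →
      ∑' s', M.prob s a s' * M.bellmanValue D Dᶜ N s' < ⨅ n, M.bellmanValue D Dᶜ n s := by
    intro a
    by_cases ha : a ∈ M.enabled s
    · have h := hlt a ha
      rw [tsum_mul_iInf_eq _ (by rw [show ∑' s', M.prob s a s' = 1 from ha]; simp)
        antitone_bellmanValue_compl (bellmanValue_le_one 0)] at h
      obtain ⟨N, hN⟩ := iInf_lt_iff.1 h
      exact ⟨N, fun _ => hN⟩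
    · exact ⟨0, fun h => absurd h ha⟩
  choose N hN using hN
  -- From horizon `B` on, every single action falls short of the infimum.
  obtain ⟨B, hB⟩ := (hfin.image N).bddAbove
  have hle : ⨅ n, M.bellmanValue D Dᶜ n s ≤ M.bellmanValue D Dᶜ (B + 1) s := iInf_le _ _
  obtain ⟨a, ha, h⟩ := exists_bellmanValue_le_tsum_mul hfin hs
    (ne_of_gt (lt_of_lt_of_le (pos_iff_ne_zero.2 h0) hle))
  have h' : ∑' s', M.prob s a s' * M.bellmanValue D Dᶜ B s' ≤
      ∑' s', M.prob s a s' * M.bellmanValue D Dᶜ (N a) s' := by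
    gcongr with s'
    exact antitone_bellmanValue_compl (hB ⟨a, ha, rfl⟩) s'
  exact (hle.trans (h.trans h')).not_gt (hN a ha)

variable [Countable S]

theorem supProb_stoppedIn_le_bellmanValue (s : S) (hU : ∀ s ∈ U, s ∉ D → (M.enabled s).Nonempty)
    (n : ℕ) : M.supProb s (stoppedIn D U n) ≤ M.bellmanValue D U n s := by
  refine iSup_le fun σ => pathMeasure_stoppedIn_le_of_bellman σ s
    (f := fun k => M.bellmanValue D U (n - k)) (fun s' => ?_) (fun k _ s' hs' => ?_)
    (fun k hk s' hs' a ha => ?_) fun k hk s' hs' hne => ?_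
  · simp [bellmanValue]
  · exact (bellmanValue_of_mem hs' _).ge
  · obtain ⟨m, rfl⟩ := Nat.exists_eq_add_of_lt hk
    convert tsum_mul_le_bellmanValue hs' ha m using 3
    · rw [show k + m + 1 - (k + 1) = m by omega]
    · omega
  · simp only [bellmanValue_of_not_nonempty hne (fun h => hne (hU s' h hs')), le_refl]

/-- The value with horizon `m + n` is at most the optimal probability of stopping in `U'` within `n`
steps, if the indicator of `U'` dominates the value that remains after `n` steps. For `m = 0` and
`U' = U` this says that finite-horizon values are attained. -/
theorem bellmanValue_le_supProb (s : S) {U' : Set S} (m n : ℕ)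
    (hterm : ∀ s', M.bellmanValue D U m s' ≤ U'.indicator 1 s')
    (hfin : ∀ s ∉ D, (M.enabled s).Finite) :
    M.bellmanValue D U (m + n) s ≤ M.supProb s (stoppedIn D U' n) := by
  refine le_supProb_stoppedIn s (f := fun k => M.bellmanValue D U (m + (n - k)))
    (fun s' => ?_) (fun k _ s' hs' => ?_) fun k hk s' hs' h0 => ?_
  · simpa using hterm s'
  · rw [bellmanValue_of_mem hs', ← bellmanValue_of_mem (M := M) hs' m]
    exact hterm s'
  · have e : m + (n - k) = m + (n - (k + 1)) + 1 := by omega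
    simp only [e] at h0 ⊢
    exact exists_bellmanValue_le_tsum_mul (hfin s' hs') hs' h0

end BellmanValue

/-! ### Reachability, the avoid set and decisiveness -/

variable [Countable S]

theorem supProb_eventuallyIn_eq_iSup (hfin : M.FinitelyActionBranching) (s : S) (T : Set S) :
    M.supProb s (eventuallyIn T) = ⨆ n, M.bellmanValue T T n s := by
  rw [supProb_eventuallyIn]
  refine iSup_congr fun n => le_antisymm ?_ ?_
  · rw [← stoppedIn_self]
    exact supProb_stoppedIn_le_bellmanValue s (fun s h h' => absurd h h') n
  · rw [← stoppedIn_self]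
    simpa using bellmanValue_le_supProb (D := T) (U := T) (U' := T) s 0 n
      (fun _ => le_rfl) fun s _ => hfin s

theorem mem_avoidSup_iff (hfin : M.FinitelyActionBranching) {goal s : S} :
    s ∈ M.avoidSup goal ↔ ∀ n, M.bellmanValue {goal} {goal} n s = 0 := by
  rw [avoidSup, Set.mem_ofPred_eq, supProb_eventuallyIn_eq_iSup hfin, ENNReal.iSup_eq_zero]

theorem goal_notMem_avoidSup (hfin : M.FinitelyActionBranching) (goal : S) :
    goal ∉ M.avoidSup goal := fun h => by
  simpa [bellmanValue] using (mem_avoidSup_iff hfin).1 h 0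

theorem enabled_nonempty_of_notMem_avoidSup (hfin : M.FinitelyActionBranching) {goal s : S}
    (hs : s ∉ M.avoidSup goal) (hg : s ≠ goal) : (M.enabled s).Nonempty := by
  by_contra hne
  exact hs ((mem_avoidSup_iff hfin).2 fun n => bellmanValue_of_not_nonempty hne hg n)

/-- Decisiveness makes the survival values vanish in the limit: otherwise a pure positional
scheduler that attains the limit in the Bellman equation avoids `goal` and the avoid set forever
with positive probability. -/
theorem tendsto_bellmanValue_compl_of_supDecisive (hfin : M.FinitelyActionBranching)
    {goal s₀ : S} (hdec : M.SupDecisive goal s₀) :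
    Tendsto (fun n => M.bellmanValue ({goal} ∪ M.avoidSup goal) ({goal} ∪ M.avoidSup goal)ᶜ n s₀)
      atTop (𝓝 0) := by
  set D := {goal} ∪ M.avoidSup goal with hD
  have hlim := tendsto_atTop_iInf
    (f := fun n => M.bellmanValue D Dᶜ n s₀) fun _ _ h => antitone_bellmanValue_compl h s₀
  suffices h0 : ⨅ n, M.bellmanValue D Dᶜ n s₀ = 0 by rwa [h0] at hlim
  let V : S → ℝ≥0∞ := fun s => ⨅ n, M.bellmanValue D Dᶜ n s
  let good : S → A → Prop := fun s a => V s ≤ ∑' s', M.prob s a s' * V s'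
  let σ := Scheduler.ofPreference M fun _ => good
  have hV : ∀ s, V s ≤ Dᶜ.indicator 1 s := fun s => iInf_le _ 0
  have hle : ∀ n, V s₀ ≤ σ.pathMeasure s₀ (stoppedIn D Dᶜ n) := fun n =>
    le_pathMeasure_ofPreference s₀ (f := fun _ => V) (fun _ _ _ _ h => h) hV (fun _ _ s _ => hV s)
      fun _ _ s hs h0 => exists_iInf_bellmanValue_le_tsum_mul (hfin s) hs h0
  have hnull : σ.pathMeasure s₀ (eventuallyIn D)ᶜ = 0 := by
    rw [MeasureTheory.prob_compl_eq_zero_iff (measurableSet_eventuallyIn D),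
      ← hdec σ (Scheduler.isPure_ofPreference _) (Scheduler.isPositional_ofPreference _)]
    congr 1
    ext ρ
    simp only [eventuallyIn, hD, Set.mem_union, Set.mem_ofPred_eq, exists_or]
  have hinter : (eventuallyIn D)ᶜ = ⋂ n, stoppedIn D Dᶜ n := by
    ext ρ
    simp only [stoppedIn_compl, eventuallyIn, alwaysWithin, Set.mem_compl_iff, Set.mem_iInter,
      Set.mem_ofPred_eq, not_exists]
    exact ⟨fun h n k _ => h k, fun h k => h k k le_rfl⟩
  have hanti : Antitone fun n => stoppedIn D Dᶜ n := by
    intro m n hmn ρ hρ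
    simp only [stoppedIn_compl] at hρ ⊢
    exact fun k hk => hρ k (hk.trans hmn)
  rw [hinter, hanti.measure_iInter
    (fun n => (measurableSet_stoppedIn D Dᶜ n).nullMeasurableSet) ⟨0, by finiteness⟩] at hnull
  exact le_antisymm ((le_iInf hle).trans hnull.le) zero_le

end MDP

/-! ### Merging states -/

theorem mergeCompl_of_mem {S : Type*} {C : Set S} {s : S} (h : s ∈ C) :
    mergeCompl C s = some ⟨s, h⟩ := dif_pos h

theorem mergeCompl_of_notMem {S : Type*} {C : Set S} {s : S} (h : s ∉ C) :
    mergeCompl C s = none := dif_neg h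

namespace MDP

variable {S A : Type*} {M : MDP S A}

/-- Expectations after a merge are expectations before it of functions that are constant on the
merged states. -/
theorem tsum_mergeProb_mul (C : Set S) (r : A → Option C → ℝ≥0∞) (s : C) (a : A)
    {f : Option C → ℝ≥0∞} {g : S → ℝ≥0∞} (hsome : ∀ c : C, f (some c) = g c)
    (hnone : ∀ s ∉ C, g s = f none) :
    ∑' x, M.mergeProb C r (some s) a x * f x = ∑' s', M.prob s a s' * g s' := by
  refine tsum_split C _ _ (fun c => ?_) ?_
  · rw [hsome, mergeProb]
  · rw [mergeProb, ← ENNReal.tsum_mul_right]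
    exact tsum_congr fun c => by rw [hnone _ c.2]

theorem tsum_mergeProb (C : Set S) (r : A → Option C → ℝ≥0∞) (s : C) (a : A) :
    ∑' x, M.mergeProb C r (some s) a x = ∑' s', M.prob s a s' :=
  tsum_split C _ _ (fun _ => rfl) rfl

theorem enabled_mergeToLoop (C : Set S) (s : C) :
    (M.mergeToLoop C).enabled (some s) = M.enabled s := by
  ext a
  exact (tsum_mergeProb C _ s a).congr_left

theorem enabled_mergeToDead (C : Set S) (s : C) :
    (M.mergeToDead C).enabled (some s) = M.enabled s := by
  ext a
  exact (tsum_mergeProb C _ s a).congr_left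

theorem tsum_mergeToLoop_none_mul (C : Set S) (a : A) (f : Option C → ℝ≥0∞) :
    ∑' x, (M.mergeToLoop C).prob none a x * f x = f none := by
  simp [mergeToLoop, mergeProb]

/-- Merging states of value `0` into a losing sink does not change the Bellman values. -/
theorem bellmanValue_mergeToLoop {C D U : Set S} {D' U' : Set (Option C)}
    (hD : ∀ s : C, some s ∈ D' ↔ ↑s ∈ D) (hU : ∀ s : C, some s ∈ U' ↔ ↑s ∈ U)
    (hnone : none ∉ U') (h0 : ∀ n, ∀ s ∉ C, M.bellmanValue D U n s = 0) (n : ℕ) :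
    (M.mergeToLoop C).bellmanValue D' U' n none = 0 ∧
      ∀ s : C, (M.mergeToLoop C).bellmanValue D' U' n (some s) = M.bellmanValue D U n s := by
  have hind : ∀ s : C, U'.indicator (1 : Option C → ℝ≥0∞) (some s) = U.indicator 1 (s : S) :=
      fun s => by
    by_cases h : (s : S) ∈ U <;> simp [Set.indicator, hU, h]
  induction n with
  | zero => exact ⟨by simp [bellmanValue, hnone], hind⟩
  | succ n ih =>
    constructor
    · by_cases hD' : none ∈ D'
      · simp [bellmanValue_of_mem hD', hnone]
      · simp [bellmanValue_succ_of_notMem hD', tsum_mergeToLoop_none_mul, ih.1]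
    · intro s
      by_cases hs : (s : S) ∈ D
      · rw [bellmanValue_of_mem ((hD s).2 hs), bellmanValue_of_mem hs, hind]
      · rw [bellmanValue_succ_of_notMem (mt (hD s).1 hs), bellmanValue_succ_of_notMem hs,
          enabled_mergeToLoop]
        refine iSup_congr fun a => iSup_congr fun _ => ?_
        exact tsum_mergeProb_mul C _ s a ih.2 fun s' hs' => by rw [ih.1, h0 n s' hs']

/-- Redirecting transitions to a losing dead state does not increase reachability values. -/
theorem bellmanValue_mergeToDead_le {C T : Set S} {T' : Set (Option C)}
    (hT : ∀ s : C, some s ∈ T' ↔ ↑s ∈ T) (hnone : none ∉ T') (n : ℕ) :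
    (M.mergeToDead C).bellmanValue T' T' n none = 0 ∧
      ∀ s : C, (M.mergeToDead C).bellmanValue T' T' n (some s) ≤ M.bellmanValue T T n s := by
  classical
  induction n with
  | zero =>
    refine ⟨by simp [bellmanValue, hnone], fun s => ?_⟩
    by_cases h : (s : S) ∈ T <;> simp [bellmanValue, Set.indicator, hT, h]
  | succ n ih =>
    constructor
    · rw [bellmanValue_succ_of_notMem hnone]
      simp [mergeToDead, mergeProb]
    · intro s
      by_cases hs : (s : S) ∈ T
      · rw [bellmanValue_of_mem ((hT s).2 hs), bellmanValue_of_mem hs]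
        simp [Set.indicator, hT, hs]
      · rw [bellmanValue_succ_of_notMem (mt (hT s).1 hs), bellmanValue_succ_of_notMem hs,
          enabled_mergeToDead]
        gcongr with a ha
        have e := tsum_mergeProb_mul (M := M) C (fun _ _ => 0) s a
          (f := (M.mergeToDead C).bellmanValue T' T' n)
          (g := fun s' => (M.mergeToDead C).bellmanValue T' T' n (mergeCompl C s'))
          (fun c => by rw [mergeCompl_of_mem c.2]) (fun s' hs' => by rw [mergeCompl_of_notMem hs'])
        refine e.trans_le (ENNReal.tsum_le_tsum fun s' => ?_)
        gcongr
        by_cases hs' : s' ∈ C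
        · rw [mergeCompl_of_mem hs']
          exact ih.2 ⟨s', hs'⟩
        · rw [mergeCompl_of_notMem hs', ih.1]
          exact zero_le

/-! ### The collapsed MDP -/

variable [Countable S] {goal : S}

theorem toCollapsed_of_notMem {s : S} (h : s ∉ M.avoidSup goal) :
    M.toCollapsed goal s = some ⟨s, h⟩ := mergeCompl_of_mem h

theorem toCollapsed_of_mem {s : S} (h : s ∈ M.avoidSup goal) :
    M.toCollapsed goal s = none := mergeCompl_of_notMem (not_not.2 h)

theorem some_eq_toCollapsed_goal_iff (hfin : M.FinitelyActionBranching)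
    (s : ↥(M.avoidSup goal)ᶜ) : some s = M.toCollapsed goal goal ↔ (s : S) = goal := by
  rw [toCollapsed_of_notMem (goal_notMem_avoidSup hfin goal), Option.some_inj, Subtype.ext_iff]

theorem none_ne_toCollapsed_goal (hfin : M.FinitelyActionBranching) :
    none ≠ M.toCollapsed goal goal := by
  simp [toCollapsed_of_notMem (goal_notMem_avoidSup hfin goal)]

/-- The reachability values survive the collapse, whether or not one also stops at the losing
sink. -/
theorem collapsed_reachValue (hfin : M.FinitelyActionBranching)
    {D' : Set (M.CollapsedState goal)}
    (hD' : ∀ s : ↥(M.avoidSup goal)ᶜ, some s ∈ D' ↔ some s = M.toCollapsed goal goal) (n : ℕ) :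
    (M.collapsed goal).bellmanValue D' {M.toCollapsed goal goal} n none = 0 ∧
      ∀ s, (M.collapsed goal).bellmanValue D' {M.toCollapsed goal goal} n
        (M.toCollapsed goal s) = M.bellmanValue {goal} {goal} n s := by
  have h0 : ∀ n, ∀ s ∉ (M.avoidSup goal)ᶜ, M.bellmanValue {goal} {goal} n s = 0 :=
    fun n s hs => (mem_avoidSup_iff hfin).1 (not_not.1 hs) n
  have key := bellmanValue_mergeToLoop (M := M) (C := (M.avoidSup goal)ᶜ) (D := {goal})
    (U := {goal}) (D' := D') (U' := {M.toCollapsed goal goal})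
    (fun s => (hD' s).trans (some_eq_toCollapsed_goal_iff hfin s))
    (some_eq_toCollapsed_goal_iff hfin) (none_ne_toCollapsed_goal hfin) h0 n
  refine ⟨key.1, fun s => ?_⟩
  by_cases hs : s ∈ M.avoidSup goal
  · rw [toCollapsed_of_mem hs, h0 n s (not_not.2 hs)]
    exact key.1
  · rw [toCollapsed_of_notMem hs]
    exact key.2 ⟨s, hs⟩

theorem collapsed_survivalValue (hfin : M.FinitelyActionBranching) (n : ℕ) (s : S) :
    (M.collapsed goal).bellmanValue {M.toCollapsed goal goal, none}
        {M.toCollapsed goal goal, none}ᶜ n (M.toCollapsed goal s) =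
      M.bellmanValue ({goal} ∪ M.avoidSup goal) ({goal} ∪ M.avoidSup goal)ᶜ n s := by
  have hD : ∀ s : ↥(M.avoidSup goal)ᶜ, some s ∈ ({M.toCollapsed goal goal, none} : Set _) ↔
      (s : S) ∈ ({goal} ∪ M.avoidSup goal : Set S) := fun s => by
    have h1 := some_eq_toCollapsed_goal_iff hfin s
    have h2 : (s : S) ∉ M.avoidSup goal := s.2
    simp [h1, h2]
  have h0 : ∀ n, ∀ s ∉ (M.avoidSup goal)ᶜ,
      M.bellmanValue ({goal} ∪ M.avoidSup goal) ({goal} ∪ M.avoidSup goal)ᶜ n s = 0 :=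
    fun n s hs => by
      have hs' : s ∈ ({goal} ∪ M.avoidSup goal : Set S) := Or.inr (not_not.1 hs)
      rw [bellmanValue_of_mem hs', Set.indicator_of_notMem (not_not.2 hs')]
  have key := bellmanValue_mergeToLoop (M := M) (U := ({goal} ∪ M.avoidSup goal)ᶜ)
    (U' := ({M.toCollapsed goal goal, none} : Set (M.CollapsedState goal))ᶜ) hD
    (fun s => not_congr (hD s)) (fun h => h (Or.inr rfl)) h0 n
  by_cases hs : s ∈ M.avoidSup goal
  · rw [toCollapsed_of_mem hs, h0 n s (not_not.2 hs)]
    exact key.1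
  · rw [toCollapsed_of_notMem hs]
    exact key.2 ⟨s, hs⟩

theorem collapsed_enabled_finite (hfin : M.FinitelyActionBranching) {x : M.CollapsedState goal}
    (hx : x ≠ none) : ((M.collapsed goal).enabled x).Finite := by
  obtain ⟨s, rfl⟩ := Option.ne_none_iff_exists'.1 hx
  rw [collapsed, enabled_mergeToLoop]
  exact hfin s

theorem collapsed_enabled_nonempty (hfin : M.FinitelyActionBranching)
    {x : M.CollapsedState goal} (hx : x ≠ none) (hg : x ≠ M.toCollapsed goal goal) :
    ((M.collapsed goal).enabled x).Nonempty := by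
  obtain ⟨s, rfl⟩ := Option.ne_none_iff_exists'.1 hx
  rw [collapsed, enabled_mergeToLoop]
  exact enabled_nonempty_of_notMem_avoidSup hfin s.2 (mt (some_eq_toCollapsed_goal_iff hfin s).2 hg)

theorem supProb_reached_le (hfin : M.FinitelyActionBranching) (s₀ : S) (n : ℕ) :
    (M.collapsed goal).supProb (M.toCollapsed goal s₀) (M.reached goal n) ≤
      M.supProb s₀ (eventuallyIn {goal}) := by
  rw [reached, ← stoppedIn_self, supProb_eventuallyIn_eq_iSup hfin]
  refine (supProb_stoppedIn_le_bellmanValue _ (fun s h h' => absurd h h') n).trans ?_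
  rw [(collapsed_reachValue hfin (fun _ => Iff.rfl) n).2]
  exact le_iSup (fun n => M.bellmanValue {goal} {goal} n s₀) n

/-- A path that is stopped at the target or at the sink within `n` steps, and not in the sink, has
reached the target or still hopes; as the sink has value `0`, stopping there loses nothing. -/
theorem le_supProb_reached_union_hoping (hfin : M.FinitelyActionBranching) (s₀ : S) (n : ℕ) :
    M.supProb s₀ (eventuallyIn {goal}) ≤
      (M.collapsed goal).supProb (M.toCollapsed goal s₀) (M.reached goal n ∪ M.hoping goal n) := by
  have hval := collapsed_reachValue hfin (goal := goal) (D' := {M.toCollapsed goal goal, none})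
    (by simp)
  have hsub : stoppedIn {M.toCollapsed goal goal, none} {none}ᶜ n ⊆
      M.reached goal n ∪ M.hoping goal n := by
    rintro ρ ⟨k, hkn, hkU, hk, hkD⟩
    by_cases hg : ρ k = M.toCollapsed goal goal
    · exact Or.inl ⟨k, hkn, hg⟩
    · have hkD' : ρ k ∉ ({M.toCollapsed goal goal, none} : Set _) := by
        simpa [hg] using hkU
      obtain rfl := hkD.resolve_left hkD'
      refine Or.inr fun j hj => ?_
      rcases hj.eq_or_lt with rfl | hlt
      exacts [hkD', hk j hlt]
  rw [supProb_eventuallyIn_eq_iSup hfin]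
  refine iSup_le fun m => ?_
  rw [← (hval m).2]
  refine le_trans ?_ (supProb_mono _ hsub)
  refine le_trans (monotone_bellmanValue (by simp) (Nat.le_add_right m n) _)
    (bellmanValue_le_supProb _ m n (fun x => ?_) fun x hx => ?_)
  · by_cases hx : x = none
    · rw [hx, (hval m).1]
      exact zero_le
    · rw [Set.indicator_of_mem hx]
      exact bellmanValue_le_one m x
  · exact collapsed_enabled_finite hfin fun h => hx (Or.inr h)

theorem supProb_hoping_le (hfin : M.FinitelyActionBranching) (s₀ : S) (n : ℕ) :
    (M.collapsed goal).supProb (M.toCollapsed goal s₀) (M.hoping goal n) ≤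
      M.bellmanValue ({goal} ∪ M.avoidSup goal) ({goal} ∪ M.avoidSup goal)ᶜ n s₀ := by
  rw [hoping, ← stoppedIn_compl, ← collapsed_survivalValue hfin]
  refine supProb_stoppedIn_le_bellmanValue _ (fun x hx _ => ?_) n
  exact collapsed_enabled_nonempty hfin (fun h => hx (Or.inr h)) fun h => hx (Or.inl h)

/-! ### The sliced MDP -/

variable {s₀ : S}

theorem monotone_sliceSet : Monotone (M.sliceSet goal s₀) :=
  monotone_nat_of_le_succ fun _ => Set.subset_union_left

theorem sliceSet_zero_subset (n : ℕ) : M.sliceSet goal s₀ 0 ⊆ M.sliceSet goal s₀ n :=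
  monotone_sliceSet n.zero_le

theorem mem_sliceSet_succ {n : ℕ} {x x' : M.CollapsedState goal} (hx : x ∈ M.sliceSet goal s₀ n)
    {a : A} (h : (M.collapsed goal).prob x a x' ≠ 0) : x' ∈ M.sliceSet goal s₀ (n + 1) :=
  Or.inr ⟨x, hx, a, pos_iff_ne_zero.2 h⟩

theorem toCollapsed_start_mem_sliceSet (n : ℕ) :
    M.toCollapsed goal s₀ ∈ M.sliceSet goal s₀ n := sliceSet_zero_subset n (by simp [sliceSet])

theorem toCollapsed_goal_mem_sliceSet (n : ℕ) :
    M.toCollapsed goal goal ∈ M.sliceSet goal s₀ n := sliceSet_zero_subset n (by simp [sliceSet])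

theorem none_mem_sliceSet (n : ℕ) : none ∈ M.sliceSet goal s₀ n :=
  sliceSet_zero_subset n (by simp [sliceSet])

theorem toSliced_start (n : ℕ) :
    M.toSliced goal s₀ n s₀ = some ⟨_, toCollapsed_start_mem_sliceSet n⟩ := mergeCompl_of_mem _

theorem some_eq_toSliced_goal_iff (n : ℕ) (c : ↥(M.sliceSet goal s₀ n)) :
    some c = M.toSliced goal s₀ n goal ↔ (c : M.CollapsedState goal) = M.toCollapsed goal goal := by
  rw [toSliced, mergeCompl_of_mem (toCollapsed_goal_mem_sliceSet n), Option.some_inj,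
    Subtype.ext_iff]

theorem none_ne_toSliced_goal (n : ℕ) : none ≠ M.toSliced goal s₀ n goal := by
  rw [toSliced, mergeCompl_of_mem (toCollapsed_goal_mem_sliceSet n)]
  simp

/-- The sliced MDP differs from the collapsed one by transitions redirected to a losing state. -/
theorem sliced_supProb_goal_le (hfin : M.FinitelyActionBranching) (n : ℕ) :
    (M.sliced goal s₀ n).supProb (M.toSliced goal s₀ n s₀)
        (eventuallyIn {M.toSliced goal s₀ n goal}) ≤ M.supProb s₀ (eventuallyIn {goal}) := by
  rw [supProb_eventuallyIn, supProb_eventuallyIn_eq_iSup hfin]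
  refine iSup_mono fun m => ?_
  rw [← stoppedIn_self, toSliced_start,
    ← (collapsed_reachValue hfin (D' := {M.toCollapsed goal goal}) (fun _ => Iff.rfl) m).2]
  refine (supProb_stoppedIn_le_bellmanValue _ (fun s h h' => absurd h h') m).trans ?_
  exact (bellmanValue_mergeToDead_le (some_eq_toSliced_goal_iff n) (none_ne_toSliced_goal n) m).2 _

/-- Giving the fresh state the payoff `1` makes the finite-horizon reachability values of the
collapsed MDP a subsolution in the sliced MDP. -/
theorem le_sliced_supProb_goal_or_none (hfin : M.FinitelyActionBranching) (n : ℕ) :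
    M.supProb s₀ (eventuallyIn {goal}) ≤
      (M.sliced goal s₀ n).supProb (M.toSliced goal s₀ n s₀)
        (eventuallyIn {M.toSliced goal s₀ n goal, none}) := by
  classical
  rw [supProb_eventuallyIn (M := M.sliced goal s₀ n), supProb_eventuallyIn_eq_iSup hfin]
  refine iSup_mono fun m => ?_
  have hval := collapsed_reachValue hfin (goal := goal) (D' := {M.toCollapsed goal goal})
    (fun _ => Iff.rfl)
  set W := (M.collapsed goal).bellmanValue {M.toCollapsed goal goal} {M.toCollapsed goal goal}
    with hW
  have hU : ∀ j (x : Option ↥(M.sliceSet goal s₀ n)), x.elim 1 (fun c => W j c) ≤ 1 := by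
    rintro j (_ | c)
    exacts [le_rfl, bellmanValue_le_one j _]
  rw [← stoppedIn_self, toSliced_start, ← (hval m).2]
  refine le_supProb_stoppedIn (M := M.sliced goal s₀ n) (some ⟨_, _⟩)
    (f := fun k (x : Option ↥(M.sliceSet goal s₀ n)) => x.elim 1 fun c => W (m - k) c)
    (fun x => ?_) (fun k _ x hx => ?_)
    fun k hk x hx h0 => ?_
  · rcases x with _ | c
    · simp
    · by_cases hc : some c = M.toSliced goal s₀ n goal
      · have hmem : some c ∈ ({M.toSliced goal s₀ n goal, none} : Set _) := Or.inl hc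
        rw [Set.indicator_of_mem hmem]
        exact hU _ _
      · have hc' := mt (some_eq_toSliced_goal_iff n c).2 hc
        simp [hW, bellmanValue, hc']
  · rw [Set.indicator_of_mem hx]
    exact hU _ _
  · rcases x with _ | c
    · exact absurd (Or.inr rfl) hx
    have hc : (c : M.CollapsedState goal) ∉ ({M.toCollapsed goal goal} : Set _) := fun h =>
      hx (Or.inl ((some_eq_toSliced_goal_iff n c).2 h))
    have hcn : (c : M.CollapsedState goal) ≠ none := fun h => h0 (by
      rw [Option.elim_some, h, (hval _).1])
    obtain ⟨j, rfl⟩ := Nat.exists_eq_add_of_lt hk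
    rw [show k + j + 1 - (k + 1) = j by omega]
    rw [show k + j + 1 - k = j + 1 by omega] at h0 ⊢
    obtain ⟨a, ha, hle⟩ := exists_bellmanValue_le_tsum_mul (collapsed_enabled_finite hfin hcn) hc h0
    refine ⟨a, by rwa [sliced, enabled_mergeToDead], hle.trans ?_⟩
    have e := tsum_mergeProb_mul (M := M.collapsed goal) (M.sliceSet goal s₀ n) (fun _ _ => 0) c a
      (f := fun x : Option ↥(M.sliceSet goal s₀ n) => x.elim 1 fun c => W j c)
      (g := fun x => if x ∈ M.sliceSet goal s₀ n then W j x else 1)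
      (fun c => by simp) (fun s' hs' => by simp [hs'])
    refine (ENNReal.tsum_le_tsum fun x => ?_).trans e.ge
    gcongr
    split_ifs
    exacts [le_rfl, bellmanValue_le_one j x]

/-- Up to time `n` a path of the sliced MDP stays among the states kept at level `n`, so a path that
reaches the fresh state before the target has survived for `n` steps. -/
theorem sliced_pathMeasure_none_first_le (hfin : M.FinitelyActionBranching) (n m : ℕ)
    (σ : (M.sliced goal s₀ n).Scheduler) :
    σ.pathMeasure (M.toSliced goal s₀ n s₀)
        (stoppedIn {M.toSliced goal s₀ n goal, none} {none} m) ≤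
      M.bellmanValue ({goal} ∪ M.avoidSup goal) ({goal} ∪ M.avoidSup goal)ᶜ n s₀ := by
  classical
  rw [← collapsed_survivalValue hfin]
  set D : Set (M.CollapsedState goal) := {M.toCollapsed goal goal, none} with hD
  set Y := (M.collapsed goal).bellmanValue D Dᶜ with hY
  have hYnone : ∀ j, Y j none = 0 := fun j => by
    have hn : none ∈ D := Or.inr rfl
    rw [hY, bellmanValue_of_mem hn, Set.indicator_of_notMem (not_not.2 hn)]
  -- The trivial bound `1` is used at the states that cannot be reached within `k` steps.
  let V : ℕ → M.CollapsedState goal → ℝ≥0∞ := fun k x =>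
    if x ∈ M.sliceSet goal s₀ k then Y (n - k) x else 1
  have hV1 : ∀ k x, V k x ≤ 1 := fun k x => by
    simp only [V]
    split_ifs
    exacts [bellmanValue_le_one _ x, le_rfl]
  have hVnone : ∀ k, V k none = 0 := fun k => by
    simp only [V, if_pos (none_mem_sliceSet k), hYnone]
  have hstart : V 0 (M.toCollapsed goal s₀) = Y n (M.toCollapsed goal s₀) := by
    simp only [V, if_pos (toCollapsed_start_mem_sliceSet 0), Nat.sub_zero]
  have hind : ∀ k (x : Option ↥(M.sliceSet goal s₀ n)),
      ({none} : Set (Option ↥(M.sliceSet goal s₀ n))).indicator 1 x ≤ x.elim 1 fun c => V k c := by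
    rintro k (_ | c) <;> simp
  rw [toSliced_start, ← hstart]
  refine pathMeasure_stoppedIn_le_of_bellman σ (some ⟨_, _⟩)
    (f := fun k (x : Option ↥(M.sliceSet goal s₀ n)) => x.elim 1 fun c => V k c) (hind m)
    (fun k _ x _ => hind k x)
    (fun k _ x hx a ha => ?_) fun k _ x hx hne => ?_
  · rcases x with _ | c
    · exact absurd (Or.inr rfl) hx
    have e := tsum_mergeProb_mul (M := M.collapsed goal) (M.sliceSet goal s₀ n) (fun _ _ => 0) c a
      (f := fun x : Option ↥(M.sliceSet goal s₀ n) => x.elim 1 fun c => V (k + 1) c)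
      (g := fun x => if x ∈ M.sliceSet goal s₀ n then V (k + 1) x else 1)
      (fun c => by simp) (fun s' hs' => by simp [hs'])
    refine e.trans_le ?_
    rw [Option.elim_some]
    by_cases hcn : (c : M.CollapsedState goal) = none
    · rw [hcn, collapsed, tsum_mergeToLoop_none_mul, if_pos (none_mem_sliceSet n), hVnone]
      exact zero_le
    have hcD : (c : M.CollapsedState goal) ∉ D := by
      rintro (h | h)
      · exact hx (Or.inl ((some_eq_toSliced_goal_iff n c).2 h))
      · exact hcn h
    have hle1 : ∑' x, (M.collapsed goal).prob c a x *
        (if x ∈ M.sliceSet goal s₀ n then V (k + 1) x else 1) ≤ 1 :=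
      tsum_prob_mul_le_of_le _ a fun x => by
        split_ifs
        exacts [hV1 _ x, le_rfl]
    by_cases hck : (c : M.CollapsedState goal) ∈ M.sliceSet goal s₀ k
    · rcases lt_or_ge k n with hkn | hkn
      · obtain ⟨j, rfl⟩ := Nat.exists_eq_add_of_lt hkn
        rw [sliced, enabled_mergeToDead] at ha
        have hVc : V k c = Y (j + 1) c := by
          simp only [V, if_pos hck, show k + j + 1 - k = j + 1 by omega]
        rw [hVc]
        refine le_trans (ENNReal.tsum_le_tsum fun x => ?_) (tsum_mul_le_bellmanValue hcD ha j)
        by_cases hx0 : (M.collapsed goal).prob c a x = 0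
        · simp [hx0]
        have hxk := mem_sliceSet_succ hck hx0
        rw [if_pos (monotone_sliceSet (by omega) hxk)]
        simp only [V, if_pos hxk, show k + j + 1 - (k + 1) = j by omega]
        exact le_rfl
      · refine hle1.trans ?_
        simp only [V, if_pos hck, Nat.sub_eq_zero_of_le hkn, hY, bellmanValue]
        rw [Set.indicator_of_mem hcD]
        exact le_rfl
    · simpa only [V, if_neg hck] using hle1
  · rcases x with _ | c
    · exact absurd (Or.inr rfl) hx
    rw [sliced, enabled_mergeToDead] at hne
    have hcn : (c : M.CollapsedState goal) = none := by
      by_contra hcn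
      exact hne (collapsed_enabled_nonempty hfin hcn fun h =>
        hx (Or.inl ((some_eq_toSliced_goal_iff n c).2 h)))
    simp only [Option.elim_some, hcn, hVnone, le_refl]

/-- A path that reaches the target or the fresh state reaches the target, or the fresh state before
the target. -/
theorem sliced_supProb_goal_or_none_le (hfin : M.FinitelyActionBranching) (n : ℕ) :
    (M.sliced goal s₀ n).supProb (M.toSliced goal s₀ n s₀)
        (eventuallyIn {M.toSliced goal s₀ n goal, none}) ≤
      (M.sliced goal s₀ n).supProb (M.toSliced goal s₀ n s₀)
          (eventuallyIn {M.toSliced goal s₀ n goal}) +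
        M.bellmanValue ({goal} ∪ M.avoidSup goal) ({goal} ∪ M.avoidSup goal)ᶜ n s₀ := by
  classical
  set g := M.toSliced goal s₀ n goal
  have hsub : (eventuallyIn {g, none} : Set (ℕ → Option ↥(M.sliceSet goal s₀ n))) ⊆
      eventuallyIn {g} ∪ ⋃ m, stoppedIn {g, none} {none} m := by
    intro ρ hρ
    have hρ' : ∃ k, ρ k ∈ ({g, none} : Set _) := hρ
    rcases Nat.find_spec hρ' with h | h
    · exact Or.inl ⟨_, h⟩
    · exact Or.inr (Set.mem_iUnion.2 ⟨_, _, le_rfl, h, fun j hj => Nat.find_min hρ' hj, Or.inr rfl⟩)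
  have hmono : Monotone fun m => stoppedIn {g, none} {none} m := by
    rintro m m' hm ρ ⟨k, hkm, hkU, hk, -⟩
    exact ⟨k, hkm.trans hm, hkU, hk, Or.inl (Or.inr hkU)⟩
  refine iSup_le fun σ => (MeasureTheory.measure_mono hsub).trans
    ((MeasureTheory.measure_union_le _ _).trans (add_le_add ?_ ?_))
  · exact le_iSup (fun σ : (M.sliced goal s₀ n).Scheduler => σ.pathMeasure _ (eventuallyIn {g})) σ
  · rw [hmono.measure_iUnion]
    exact iSup_le fun m => sliced_pathMeasure_none_first_le hfin n m σ

end MDP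

/-! ### The approximation schemes -/

/-- Bounds in `[0, 1]` that enclose `p`, with a gap that tends to `0`, give a correct scheme. -/
theorem terminatesAndCorrect_of_gap {lo hi : ℕ → ℝ≥0∞} {p : ℝ≥0∞} {δ : ℕ → ℝ≥0∞} (hp : p ≤ 1)
    (hhi : ∀ n, hi n ≤ 1) (hlo_le : ∀ n, lo n ≤ p) (hle_hi : ∀ n, p ≤ hi n)
    (hgap : ∀ n, hi n ≤ lo n + δ n) (hδ : Tendsto δ atTop (𝓝 0)) :
    TerminatesAndCorrect (fun n => (lo n).toReal) (fun n => (hi n).toReal) p.toReal := by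
  have hp' : p ≠ ∞ := ne_top_of_le_ne_top (by simp) hp
  have hhi' : ∀ n, hi n ≠ ∞ := fun n => ne_top_of_le_ne_top (by simp) (hhi n)
  have hlo' : ∀ n, lo n ≠ ∞ := fun n => ne_top_of_le_ne_top hp' (hlo_le n)
  have h1 : ∀ n, (lo n).toReal ≤ p.toReal := fun n => ENNReal.toReal_mono hp' (hlo_le n)
  have h2 : ∀ n, p.toReal ≤ (hi n).toReal := fun n => ENNReal.toReal_mono (hhi' n) (hle_hi n)
  refine ⟨fun n => ⟨h1 n, h2 n⟩, fun ε hε => ⟨?_, ?_⟩⟩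
  · obtain ⟨n, hn, hn1⟩ := ((hδ.eventually_le_const (ENNReal.ofReal_pos.2 hε)).and
      (eventually_ge_atTop 1)).exists
    refine ⟨n, hn1, ?_⟩
    rw [abs_of_nonneg (sub_nonneg.2 ((h1 n).trans (h2 n))), sub_le_iff_le_add']
    have h := ENNReal.toReal_mono (ENNReal.add_ne_top.2 ⟨hlo' n, ENNReal.ofReal_ne_top⟩)
      ((hgap n).trans (add_le_add_right hn (lo n)))
    rwa [ENNReal.toReal_add (hlo' n) ENNReal.ofReal_ne_top, ENNReal.toReal_ofReal hε.le] at h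
  · classical
    rintro v ⟨hdom, rfl⟩
    have hspec := (Nat.find_spec hdom).2
    simp only [repeatUntilClose] at hspec ⊢
    refine ⟨⟨ENNReal.toReal_nonneg, (h1 _).trans ?_⟩, ?_⟩
    · simpa using ENNReal.toReal_mono (by simp) hp
    · rw [abs_of_nonneg (sub_nonneg.2 ((h1 _).trans (h2 _)))] at hspec
      rw [abs_of_nonpos (sub_nonpos.2 (h1 _))]
      linarith [h2 (Nat.find hdom)]

theorem theorem5 {S A : Type*} [Countable S] [Countable A] (M : MDP S A) (s₀ goal : S)
    (hfin : M.FinitelyActionBranching) (hdec : M.SupDecisive goal s₀) :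
    Tendsto (fun n => (M.collapsed goal).supProb (M.toCollapsed goal s₀) (M.hoping goal n))
        atTop (𝓝 0) ∧
      TerminatesAndCorrect (M.lower₁ goal s₀) (M.upper₁ goal s₀)
        (M.supProb s₀ (eventuallyIn {goal})).toReal ∧
      TerminatesAndCorrect (M.lower₂ goal s₀) (M.upper₂ goal s₀)
        (M.supProb s₀ (eventuallyIn {goal})).toReal := by
  have hlim := MDP.tendsto_bellmanValue_compl_of_supDecisive hfin hdec
  have hhope : Tendsto (fun n => (M.collapsed goal).supProb (M.toCollapsed goal s₀)
      (M.hoping goal n)) atTop (𝓝 0) :=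
    tendsto_of_tendsto_of_tendsto_of_le_of_le tendsto_const_nhds hlim (fun _ => zero_le)
      fun n => MDP.supProb_hoping_le hfin s₀ n
  refine ⟨hhope, ?_, ?_⟩
  · exact terminatesAndCorrect_of_gap (MDP.supProb_le_one _ _) (fun _ => MDP.supProb_le_one _ _)
      (MDP.supProb_reached_le hfin s₀) (MDP.le_supProb_reached_union_hoping hfin s₀)
      (fun n => MDP.supProb_union_le _ _ _) hhope
  · exact terminatesAndCorrect_of_gap (MDP.supProb_le_one _ _) (fun _ => MDP.supProb_le_one _ _)
      (MDP.sliced_supProb_goal_le hfin) (MDP.le_sliced_supProb_goal_or_none hfin)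
      (MDP.sliced_supProb_goal_or_none_le hfin) hlim
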